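/- **Setting.** Let $\mathcal A$ be a finite alphabet with a distinguished letter $0$, and let $\theta$ be a substitution on $\mathcal A$ of constant length $r$ such that: - $\theta$ is primitive (for some $k\ge 1$ every letter occurs in every $\theta^k(a)$) and admissible ($\theta$ is injective on letters and its right-infinite fixed words are not periodic); - $\theta$ is coincidence-free ($\theta(a)_n\ne\theta(b)_n$ whenever $a\neq b$ and $0\le n<r$); - $\theta$ is in canonical form ($\theta(a)_0=\theta(a)_{r-1}=a$ for every letter $a$). A finite word is *legal* if it is a subword of some $\theta^k(a)$; $P_\theta$ is the set of legal two-letter words. For a substitution $\phi$, $X_\phi$ is the two-sided shift space of all bi-infinite words whose finite subwords are subwords of words $\phi^k(b)$, and $\sigma$ is the left shift on it. **Height and classes.** Let $d$ be the greatest common divisor of all $n\ge1$ such that the right-infinite fixed word of $\theta$ beginning with $0$ has the letter $0$ at position $n$, and let the height $m=m(\theta)$ be the product of the prime factors of $d$, with multiplicity, that do not divide $r$. For a letter $a$ let $z(a)$ be the first position of $0$ in the right-infinite fixed word of $\theta$ beginning with $a$, and for $p\ge0$ put $S_p=\{a: z(a)\equiv -p \bmod m\}$. Let $P(i,j,k)=\{\theta^k(p)_j\,\theta^k(p)_{j+1}: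 p\in S_i\}$ for $0\le i<m$, $k\ge1$, $0\le j\le r^k-2$. Assume that the collection of the sets $P(i,j,k)$ is a partition of $P_\theta$, and let $[ab]$ denote the class of $ab\in P_\theta$. **The substitution $\phi$.** Let $\mathcal B$ be the set of classes. For $b\in\mathcal B$ let $a_b$ be a last letter of a word in the class $b$, and put $\phi(b)=b_0\dots b_{r-1}$ with $b_0=b$ and $b_h=[\theta(a_b)_{h-1}\theta(a_b)_h]$ for $1\le h<r$. Let $0_{\mathcal B}\in\mathcal B$ be any class such that the last letters of its words lie in $S_0$. **The adding machine.** Let $\mathbb Z(r)$ be the $r$-adic adding machine of digit sequences $z=z_0z_1\dots$, with the product topology and addition with carry. **Theorem.** There is a map $\Psi=(\alpha,f):X_\phi\to\mathbb Z_m\times\mathbb Z(r)$ which is well defined by - $\alpha(x)=-\min\{i\ge1: x_i=0_{\mathcal B}\}\bmod m$, and - $f(x)=z$ if and only if, for all $k\ge1$, the subword of $x$ of length $r^{k+1}$ starting at position $-\sum_{i=0}^k z_ir^i$ equals $\phi^{k+1}(b)$ for some $b\in\mathcal B$. It is a factor map (continuous, onto, and $\Psi(\sigma x)=\Psi(x)+(1,1)$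 for all $x$), and it is one-to-one on the set of all $x\in X_\phi$ that do not lie in the shift orbit of any bi-infinite fixed point of $\phi$. -/

import Mathlib

namespace Subst

variable {A : Type*}

/-! ### Substitutions, legal words, the shift space -/

/-- The action of a substitution on finite words, by concatenation. -/
def apply (θ : A → List A) (w : List A) : List A := w.flatMap θ

/-- The word `θ^k(a)`. -/
def power (θ : A → List A) (k : ℕ) (a : A) : List A := (apply θ)^[k] [a]

/-- `θ` has constant length `r`. -/
def ConstantLength (θ : A → List A) (r : ℕ) : Prop := ∀ a, (θ a).length = r

/-- Some power of `θ` maps every letter to a word in which every letter occurs. -/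
def IsPrimitive (θ : A → List A) : Prop := ∃ k, 1 ≤ k ∧ ∀ a b, b ∈ power θ k a

/-- Distinct letters have images that differ in every column. -/
def CoincidenceFree (θ : A → List A) (r : ℕ) : Prop :=
  ∀ a b, a ≠ b → ∀ n < r, (θ a)[n]? ≠ (θ b)[n]?

/-- Every `θ(a)` begins and ends with `a`. -/
def Canonical (θ : A → List A) : Prop :=
  ∀ a, (θ a).head? = some a ∧ (θ a).getLast? = some a

/-- The right-infinite word `w` satisfies `θ(w) = w` (for `θ` of constant length `r`). -/
def IsFixedWord (θ : A → List A) (r : ℕ) (w : ℕ → A) : Prop :=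
  ∀ n i : ℕ, i < r → (θ (w n))[i]? = some (w (r * n + i))

/-- The bi-infinite word `x` satisfies `θ(x) = x`, the image of `x` at `0` being placed at `0`. -/
def IsFixedPoint (θ : A → List A) (r : ℕ) (x : ℤ → A) : Prop :=
  ∀ (n : ℤ) (i : ℕ), i < r → (θ (x n))[i]? = some (x (r * n + i))

/-- `θ` is injective on letters and its right-infinite fixed words are not periodic. -/
def Admissible (θ : A → List A) (r : ℕ) : Prop :=
  Function.Injective θ ∧
    ∀ w, IsFixedWord θ r w → ¬ ∃ q, 1 ≤ q ∧ ∀ n, w (n + q) = w n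

/-- A finite word is legal if it is a subword of some `θ^k(a)`. -/
def Legal (θ : A → List A) (w : List A) : Prop := ∃ k a, w <:+: power θ k a

/-- The word `x_s x_{s+1} … x_{s+L-1}`. -/
def window (x : ℤ → A) (s : ℤ) (L : ℕ) : List A := (List.range L).map fun i : ℕ => x (s + i)

/-- The substitution shift space `X_θ`: the bi-infinite words all of whose finite subwords are
legal. For primitive `θ` this is the shift-orbit closure of any bi-infinite fixed point of `θ`
with a legal seed, see `space_eq_closure_orbit`. -/
def space (θ : A → List A) : Set (ℤ → A) := {x | ∀ s L, Legal θ (window x s L)}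

/-- The left shift. -/
def shift (x : ℤ → A) : ℤ → A := fun i => x (i + 1)

/-- The two-sided shift orbit. -/
def orbit (w : ℤ → A) : Set (ℤ → A) := {x | ∃ n : ℤ, ∀ i, x i = w (i + n)}

theorem window_translate (x : ℤ → A) (n s : ℤ) (L : ℕ) :
    window (fun i => x (i + n)) s L = window x (s + n) L := by
  simp only [window]
  congr 1
  funext i
  congr 1
  ring

theorem shift_mem {θ : A → List A} {x : ℤ → A} (hx : x ∈ space θ) : shift x ∈ space θ := by
  intro s L
  have := window_translate x 1 s L
  rw [show shift x = fun i => x (i + 1) from rfl, this]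
  exact hx _ _

/-- The shift as a self-map of the shift space. -/
def spaceShift (θ : A → List A) (x : space θ) : space θ := ⟨shift x.1, shift_mem x.2⟩

theorem power_succ (θ : A → List A) (k : ℕ) (a : A) :
    power θ (k + 1) a = apply θ (power θ k a) :=
  Function.iterate_succ_apply' _ _ _

theorem window_fixed {θ : A → List A} {r : ℕ} (hlen : ConstantLength θ r) {x : ℤ → A}
    (hx : IsFixedPoint θ r x) (s : ℤ) (L : ℕ) :
    apply θ (window x s L) = window x (r * s) (r * L) := by
  induction L with
  | zero => simp [apply, window]
  | succ L ih =>
    have h1 : θ (x (s + L)) = (List.range r).map fun i : ℕ => x (r * (s + L) + i) := by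
      apply List.ext_getElem?
      intro i
      by_cases hi : i < r
      · rw [hx _ i hi]
        simp [hi]
      · rw [List.getElem?_eq_none (by rw [hlen]; omega), List.getElem?_eq_none (by simp; omega)]
    have h2 : window x s (L + 1) = window x s L ++ [x (s + L)] := by
      simp [window, List.range_succ]
    rw [h2]
    simp only [apply, List.flatMap_append, List.flatMap_cons, List.flatMap_nil, List.append_nil]
    rw [show (window x s L).flatMap θ = apply θ (window x s L) from rfl, ih, h1]
    simp only [window, Nat.mul_succ, List.range_add, List.map_append, List.map_map]
    congr 1
    apply List.map_congr_left
    intro i _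
    simp only [Function.comp_apply]
    congr 1
    push_cast
    ring

theorem power_eq_window {θ : A → List A} {r : ℕ} (hlen : ConstantLength θ r) {x : ℤ → A}
    (hx : IsFixedPoint θ r x) (k : ℕ) (n : ℤ) :
    power θ k (x n) = window x (r ^ k * n) (r ^ k) := by
  induction k with
  | zero => simp [power, window]
  | succ k ih =>
    rw [power_succ, ih, window_fixed hlen hx]
    congr 1
    · ring
    · ring

theorem infix_window {x : ℤ → A} {s : ℤ} {L : ℕ} {w : List A} (h : w <:+: window x s L) :
    ∃ t, w = window x t w.length := by
  obtain ⟨u, v, huv⟩ := h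
  refine ⟨s + u.length, ?_⟩
  apply List.ext_getElem (by simp [window])
  intro i hi _
  have hL : u.length + w.length + v.length = L := by
    have := congrArg List.length huv
    simpa [window, Nat.add_assoc] using this
  have h1 : (u ++ w ++ v)[u.length + i]? = (window x s L)[u.length + i]? := by rw [huv]
  have h2 : (u ++ w ++ v)[u.length + i]? = some w[i] := by
    rw [List.append_assoc, List.getElem?_append_right (by omega),
      List.getElem?_append_left (by omega)]
    simp [hi]
  have h3 : (window x s L)[u.length + i]? = some (x (s + (u.length + i : ℕ))) := by
    have : u.length + i < L := by omega
    simp [window, this]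
  rw [h2, h3] at h1
  simp only [window, List.getElem_map, List.getElem_range]
  rw [Option.some.injEq] at h1
  rw [h1]
  congr 1
  push_cast
  ring

/-- For primitive `θ`, the legal words are the words that occur in any given fixed point with a
legal seed. -/
theorem legal_iff_occurs {θ : A → List A} {r : ℕ} (hlen : ConstantLength θ r)
    (hprim : IsPrimitive θ) {u : ℤ → A} (hu : IsFixedPoint θ r u) (hmem : u ∈ space θ)
    (w : List A) : Legal θ w ↔ ∃ t, w = window u t w.length := by
  constructor
  · rintro ⟨k, a, hw⟩
    obtain ⟨K, -, hK⟩ := hprim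
    have h1 := hK (u 0) a
    rw [power_eq_window hlen hu] at h1
    obtain ⟨i, -, hi⟩ := List.mem_map.1 h1
    rw [← hi, power_eq_window hlen hu] at hw
    exact infix_window hw
  · rintro ⟨t, ht⟩
    rw [ht]
    exact hmem _ _

/-- For primitive `θ`, the shift space is the orbit closure of any fixed point with a legal
seed. -/
theorem space_eq_closure_orbit [TopologicalSpace A] [DiscreteTopology A] {θ : A → List A} {r : ℕ}
    (hlen : ConstantLength θ r) (hprim : IsPrimitive θ) {u : ℤ → A} (hu : IsFixedPoint θ r u)
    (hmem : u ∈ space θ) : space θ = closure (orbit u) := by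
  ext y
  have hb : (nhds y).HasBasis (fun _ : Finset ℤ => True) fun I => {z | ∀ i ∈ I, z i = y i} := by
    refine ⟨fun t => ?_⟩
    constructor
    · intro ht
      rw [nhds_pi, Filter.mem_pi'] at ht
      obtain ⟨I, U, hU, hsub⟩ := ht
      refine ⟨I, trivial, fun z hz => hsub fun i hi => ?_⟩
      rw [hz i hi]
      exact mem_of_mem_nhds (hU i)
    · rintro ⟨I, -, hI⟩
      refine Filter.mem_of_superset ?_ hI
      have : {z : ℤ → A | ∀ i ∈ I, z i = y i} = ⋂ i ∈ I, {z | z i = y i} := by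
        ext; simp
      rw [this, Filter.biInter_finset_mem]
      intro i _
      have ho : IsOpen ((fun z : ℤ → A => z i) ⁻¹' {y i}) :=
        (isOpen_discrete {y i}).preimage (continuous_apply i)
      exact ho.mem_nhds rfl
  rw [mem_closure_iff_nhds_basis hb]
  · constructor
    · intro hy I _
      obtain ⟨N, hN⟩ : ∃ N : ℕ, ∀ i ∈ I, -(N : ℤ) ≤ i ∧ i < N := by
        refine ⟨∑ i ∈ I, (i.natAbs + 1), fun i hi => ?_⟩
        have := Finset.single_le_sum (f := fun i : ℤ => i.natAbs + 1)
          (fun _ _ => Nat.zero_le _) hi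
        omega
      obtain ⟨t, ht⟩ := (legal_iff_occurs hlen hprim hu hmem _).1 (hy (-(N : ℤ)) (2 * N))
      refine ⟨fun i => u (i + (t + N)), ⟨t + N, fun _ => rfl⟩, fun i hi => ?_⟩
      obtain ⟨h1, h2⟩ := hN i hi
      have hl : (window y (-(N : ℤ)) (2 * N)).length = 2 * N := by simp [window]
      rw [hl] at ht
      have h3 := congrArg (fun l => l[(i + N).toNat]?) ht
      have h4 : (i + N).toNat < 2 * N := by omega
      have h5 : ((i + N).toNat : ℤ) = i + N := Int.toNat_of_nonneg (by omega)
      simp only [window, List.getElem?_map, List.getElem?_range h4, Option.map_some, h5,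
        Option.some.injEq] at h3
      have h6 : -(N : ℤ) + (i + N) = i := by ring
      have h7 : t + (i + N) = i + (t + N) := by ring
      rw [h6, h7] at h3
      exact h3.symm
    · intro h s L
      obtain ⟨z, ⟨n, hn⟩, hz⟩ := h ((Finset.range L).image fun i : ℕ => s + (i : ℤ)) trivial
      have : window y s L = window u (s + n) L := by
        rw [← window_translate]
        apply List.map_congr_left
        intro i hi
        change y (s + i) = u (s + i + n)
        rw [← hn, hz]
        exact Finset.mem_image_of_mem _ (by simpa using hi)
      rw [this]
      exact hmem _ _

/-! ### Height and the classes of letters -/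

/-- The positive positions of the letter `o` in the right-infinite fixed word beginning with `o`,
whose prefixes are the words `θ^k(o)`. -/
def returnSet (θ : A → List A) (o : A) : Set ℕ :=
  {n | 1 ≤ n ∧ ∃ k, (power θ k o)[n]? = some o}

/-- The greatest common divisor of the set of return positions. -/
noncomputable def returnGcd (θ : A → List A) (o : A) : ℕ :=
  sSup {d : ℕ | ∀ n ∈ returnSet θ o, d ∣ n}

/-- `n^*`: the product, with multiplicity, of the prime factors of `n` that do not divide `r`. -/
def primeToPart (r n : ℕ) : ℕ := (n.primeFactorsList.filter fun p => ¬ p ∣ r).prod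

/-- The height `m(θ)`, with `o` in the role of the letter `0`. -/
noncomputable def height (θ : A → List A) (o : A) (r : ℕ) : ℕ := primeToPart r (returnGcd θ o)

/-- The first position of `o` in the right-infinite fixed word beginning with `a`. When `o` occurs
in `θ(a)` this is the first position of `o` in `θ(a)`. -/
noncomputable def firstOcc (θ : A → List A) (o a : A) : ℕ :=
  sInf {n | ∃ k, (power θ k a)[n]? = some o}

/-- The class `S_p` of letters. -/
def letterClass (θ : A → List A) (o : A) (r : ℕ) (p : ℕ) : Set A :=
  {a | (firstOcc θ o a : ℤ) ≡ -(p : ℤ) [ZMOD (height θ o r)]}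

/-! ### The classes of legal two-letter words and the substitution on them -/

/-- The set `P_θ` of legal two-letter words. -/
def legalPairs (θ : A → List A) : Set (A × A) := {w | Legal θ [w.1, w.2]}

/-- `P(i,j,k)`: the two-letter words at position `j` of the words `θ^k(p)`, `p ∈ S_i`. -/
def pairSet (θ : A → List A) (o : A) (r i j k : ℕ) : Set (A × A) :=
  {w | ∃ p ∈ letterClass θ o r i,
    (power θ k p)[j]? = some w.1 ∧ (power θ k p)[j + 1]? = some w.2}

/-- The collection of all `P(i,j,k)`, `0 ≤ i < m(θ)`, `k ≥ 1`, `0 ≤ j ≤ r^k - 2`. -/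
def pairFamily (θ : A → List A) (o : A) (r : ℕ) : Set (Set (A × A)) :=
  {C | ∃ i j k, i < height θ o r ∧ 1 ≤ k ∧ j + 2 ≤ r ^ k ∧ C = pairSet θ o r i j k}

/-- The collection of the `P(i,j,k)` is a partition of `P_θ`. -/
def PairPartition (θ : A → List A) (o : A) (r : ℕ) : Prop :=
  ∅ ∉ pairFamily θ o r ∧ (pairFamily θ o r).PairwiseDisjoint id ∧
    ⋃₀ pairFamily θ o r = legalPairs θ

/-- The alphabet `ℬ`: legal two-letter words, two of them being identified when they lie in a
common `P(i,j,k)`. Under `PairPartition` its elements are exactly the classes of the partition. -/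
def PairClass (θ : A → List A) (o : A) (r : ℕ) : Type _ :=
  Quot fun v w : legalPairs θ => ∃ C ∈ pairFamily θ o r, v.1 ∈ C ∧ w.1 ∈ C

/-- The class `[ab]` of a legal two-letter word `ab`. -/
def pairClass (θ : A → List A) (o : A) (r : ℕ) (w : legalPairs θ) : PairClass θ o r := Quot.mk _ w

/-- Alphabets carry the discrete topology. -/
instance (θ : A → List A) (o : A) (r : ℕ) : TopologicalSpace (PairClass θ o r) := ⊥

theorem legal_consecutive (θ : A → List A) (a : A) (h : ℕ) (h1 : h + 1 < (θ a).length) :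
    ((θ a)[h], (θ a)[h + 1]) ∈ legalPairs θ := by
  refine ⟨1, a, (θ a).take h, (θ a).drop (h + 2), ?_⟩
  have e : power θ 1 a = θ a := by simp [power, apply]
  rw [e]
  conv_rhs => rw [← List.take_append_drop h (θ a), List.drop_eq_getElem_cons (by omega),
    List.drop_eq_getElem_cons h1]
  simp

/-- The last letter of a chosen word in the class `b`. -/
noncomputable def lastLetter (θ : A → List A) (o : A) (r : ℕ) (b : PairClass θ o r) : A :=
  (Quot.out b).1.2

/-- The substitution `φ` on `ℬ`: with `a` a last letter of a word in the class `b`,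
`φ(b)_0 = b`, and `φ(b)_h = [θ(a)_{h-1} θ(a)_h]` for `1 ≤ h < r`. -/
noncomputable def pairSubst (θ : A → List A) (o : A) (r : ℕ) (b : PairClass θ o r) :
    List (PairClass θ o r) :=
  b :: List.ofFn fun h : Fin ((θ (lastLetter θ o r b)).length - 1) =>
    pairClass θ o r ⟨_, legal_consecutive θ (lastLetter θ o r b) h (by omega)⟩

/-! ### The adding machine and the map to the equicontinuous factor -/

/-- Addition of `1 = 100…` in the `r`-adic adding machine `ℤ(r)`, whose elements are the digit
sequences `z_0 z_1 z_2 …`: a digit is increased by one modulo `r` exactly when all earlier digits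
are `r - 1`. -/
def odometer {r : ℕ} (z : ℕ → Fin r) : ℕ → Fin r := fun n =>
  open Classical in
  if ∀ i < n, (z i : ℕ) + 1 = r then
    ⟨((z n : ℕ) + 1) % r, Nat.mod_lt _ ((Nat.zero_le _).trans_lt (z n).isLt)⟩
  else z n

/-- `B` is a basic `r^k`-block. -/
def IsBasicBlock (φ : A → List A) (k : ℕ) (B : List A) : Prop := ∃ a, B = power φ k a

/-- For all `k ≥ 1`, the word of length `r^(k+1)` in `x` that starts at position
`-(z_0 + z_1 r + … + z_k r^k)` is a basic block. This is the description of `f(x) = z`. -/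
def IsAddress (φ : A → List A) (r : ℕ) (x : ℤ → A) (z : ℕ → Fin r) : Prop :=
  ∀ k : ℕ, 1 ≤ k → IsBasicBlock φ (k + 1)
    (window x (-∑ i ∈ Finset.range (k + 1), ((z i : ℕ) : ℤ) * (r : ℤ) ^ i) (r ^ (k + 1)))

/-- `c = -p(x)` modulo `m`, where `p(x)` is the least `i ≥ 1` with `x_i = o`. This is the
description of `α(x) = c`. -/
def IsPhase (o : A) (m : ℕ) (x : ℤ → A) (c : ZMod m) : Prop :=
  ∃ p : ℕ, IsLeast {i : ℕ | 1 ≤ i ∧ x i = o} p ∧ c = -(p : ZMod m)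

/-- `π` is a factor map from `(X, T)` onto `(Y, S)`. -/
def IsFactorMap {X Y : Type*} [TopologicalSpace X] [TopologicalSpace Y] (T : X → X) (S : Y → Y)
    (π : X → Y) : Prop :=
  Continuous π ∧ Function.Surjective π ∧ Function.Semiconj π T S

end Subst

namespace Subst

variable {A : Type*}

/-! ### Powers of substitutions of constant length and their right-infinite fixed words -/

/-! Let `b` be the class written `0_ℬ`, `v` the right-infinite fixed word of `φ` beginning with `b`,
and `u` that of `θ` beginning with the chosen last letter of `b`. Everything rests on the identity
`v_{n+1} = [u_n u_{n+1}]` (`fixedWord_pairSubst_succ`).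

Canonical form makes `r - 1` a return position, so `r ≡ 1` modulo `m`, and the type of `u_n` (the
index `p` of its class `S_p`) increases by one with `n`. Hence a letter of `v` determines its
position modulo `m`. Conversely, write `N = r^k q + h + 1` with `h + 1 < r^k`: then `v_N` is the
class of the pair at column `h` of `θ^k(u_q)`, which depends only on `k`, `h` and the type of `u_q`.
So `v_N` is determined by `N` modulo `m` and modulo any `r^k` not dividing `N`
(`fixedWord_pairSubst_congr`). Coincidence-freeness transfers non-periodicity from `u` to `v`.

The structure `CongruenceGenerated` retains just such facts, and the dynamics uses nothing else.
Each `x` in `X_φ` is a limit of shifts of `v` by integers `M` converging to some `(c, z)` in `ℤ_m ×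
ℤ(r)`, and by compactness every `(c, z)` arises. The pair can be read off `x`: `c` from the first
occurrence of `b`, and `z` because long blocks `φ^k(a)` start in `v` only at multiples of a high
power of `r` (`exists_recognition_level`). Thus `IsGeneratedBy` is the graph of `Ψ`; it is closed,
whence continuity. Finally `(c, z)` determines `x_n` unless `n + z = 0` in `ℤ(r)`, and in that case
the shift of `x` by `n` is a fixed point of `φ` (`eq_or_mem_orbit`). -/

theorem length_apply {θ : A → List A} {r : ℕ} (hlen : ConstantLength θ r) (w : List A) :
    (apply θ w).length = r * w.length := by
  induction w with
  | nil => simp [apply]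
  | cons a w ih =>
    simp only [apply, List.flatMap_cons, List.length_append, List.length_cons] at ih ⊢
    rw [ih, hlen]
    ring

theorem length_power {θ : A → List A} {r : ℕ} (hlen : ConstantLength θ r) (k : ℕ) (a : A) :
    (power θ k a).length = r ^ k := by
  induction k with
  | zero => simp [power]
  | succ k ih => rw [power_succ, length_apply hlen, ih, pow_succ']

theorem getElem?_apply {θ : A → List A} {r : ℕ} (hlen : ConstantLength θ r) (w : List A)
    (q i : ℕ) (hi : i < r) : (apply θ w)[r * q + i]? = w[q]?.bind fun b => (θ b)[i]? := by
  induction w generalizing q with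
  | nil => simp [apply]
  | cons a w ih =>
    simp only [apply, List.flatMap_cons] at ih ⊢
    cases q with
    | zero =>
      rw [List.getElem?_append_left (by rw [hlen]; omega)]
      simp
    | succ q =>
      rw [List.getElem?_append_right (by rw [hlen, Nat.mul_succ]; omega), hlen,
        show r * (q + 1) + i - r = r * q + i by rw [Nat.mul_succ]; omega, ih]
      simp

theorem getElem?_power_succ {θ : A → List A} {r : ℕ} (hlen : ConstantLength θ r) (k : ℕ) (a : A)
    (q i : ℕ) (hi : i < r) :
    (power θ (k + 1) a)[r * q + i]? = (power θ k a)[q]?.bind fun b => (θ b)[i]? := by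
  rw [power_succ, getElem?_apply hlen _ _ _ hi]

/-- Every `θ(a)` begins with `a`. -/
def HeadFixing (θ : A → List A) : Prop := ∀ a, (θ a)[0]? = some a

theorem getElem?_power_mono {θ : A → List A} {r : ℕ} (hlen : ConstantLength θ r)
    (hr : 2 ≤ r) (hθ : HeadFixing θ) {k l : ℕ} (hkl : k ≤ l) {a : A} {n : ℕ}
    (hn : n < r ^ k) : (power θ l a)[n]? = (power θ k a)[n]? := by
  have step : ∀ l n, n < r ^ l → (power θ (l + 1) a)[n]? = (power θ l a)[n]? := by
    intro l
    induction l with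
    | zero =>
      intro n hn
      obtain rfl : n = 0 := by simpa using hn
      have := getElem?_power_succ hlen 0 a 0 0 (by omega)
      simpa [power, hθ a] using this
    | succ l ih =>
      intro n hn
      have hi : n % r < r := Nat.mod_lt _ (by omega)
      have hq : n / r < r ^ l := Nat.div_lt_of_lt_mul (by rwa [← pow_succ'])
      rw [← Nat.div_add_mod n r, getElem?_power_succ hlen _ _ _ _ hi,
        getElem?_power_succ hlen _ _ _ _ hi, ih _ hq]
  induction l, hkl using Nat.le_induction with
  | base => rfl
  | succ l hkl ih => rw [← ih, step l n (hn.trans_le (Nat.pow_le_pow_right (by omega) hkl))]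

/-- The right-infinite word with prefixes `θ^k(a)`. -/
def fixedWord (θ : A → List A) (a : A) (n : ℕ) : A := ((power θ n a)[n]?).getD a

theorem fixedWord_zero (θ : A → List A) (a : A) : fixedWord θ a 0 = a := by
  simp [fixedWord, power]

section FixedWord

variable {θ : A → List A} {r : ℕ} (hlen : ConstantLength θ r) (hr : 2 ≤ r) (hθ : HeadFixing θ)
include hlen hr hθ

theorem getElem?_power {k n : ℕ} (a : A) (hn : n < r ^ k) :
    (power θ k a)[n]? = some (fixedWord θ a n) := by
  have h0 : n < r ^ n := Nat.lt_pow_self (by omega)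
  have h1 : (power θ k a)[n]? = (power θ n a)[n]? := by
    rcases le_total k n with h | h
    · exact (getElem?_power_mono hlen hr hθ h hn).symm
    · exact getElem?_power_mono hlen hr hθ h h0
  have h2 : n < (power θ n a).length := by rw [length_power hlen]; exact h0
  rw [h1, fixedWord, List.getElem?_eq_getElem h2]
  rfl

theorem isFixedWord_fixedWord (a : A) : IsFixedWord θ r (fixedWord θ a) := by
  intro n i hi
  have h0 : n < r ^ n := Nat.lt_pow_self (by omega)
  have h := getElem?_power_succ hlen n a n i hi
  rw [getElem?_power hlen hr hθ a h0] at h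
  rw [getElem?_power hlen hr hθ] at h
  · exact h.symm
  · rw [pow_succ']
    nlinarith

theorem power_fixedWord (a : A) (n k i : ℕ) (hi : i < r ^ k) :
    (power θ k (fixedWord θ a n))[i]? = some (fixedWord θ a (r ^ k * n + i)) := by
  induction k generalizing i with
  | zero =>
    have : i = 0 := by simpa using hi
    subst this
    simp [power]
  | succ k ih =>
    have hi' : i % r < r := Nat.mod_lt _ (by omega)
    have e : i = r * (i / r) + i % r := (Nat.div_add_mod i r).symm
    have hq : i / r < r ^ k := Nat.div_lt_of_lt_mul (by rwa [← pow_succ'])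
    rw [e, getElem?_power_succ hlen _ _ _ _ hi', ih _ hq, Option.bind_some,
      isFixedWord_fixedWord hlen hr hθ a _ _ hi']
    congr 2
    ring

theorem fixedWord_fixedWord (a : A) (n k i : ℕ) (hi : i < r ^ k) :
    fixedWord θ (fixedWord θ a n) i = fixedWord θ a (r ^ k * n + i) := by
  have h := power_fixedWord hlen hr hθ a n k i hi
  rw [getElem?_power hlen hr hθ _ hi] at h
  exact Option.some.inj h

theorem fixedWord_mul (a : A) (n : ℕ) : fixedWord θ a (r * n) = fixedWord θ a n := by
  have h := fixedWord_fixedWord hlen hr hθ a n 1 0 (by rw [pow_one]; omega)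
  rw [fixedWord_zero] at h
  simpa using h.symm

theorem mem_power_iff (a b : A) (k : ℕ) :
    b ∈ power θ k a ↔ ∃ n < r ^ k, fixedWord θ a n = b := by
  rw [List.mem_iff_getElem?]
  constructor
  · rintro ⟨n, hn⟩
    have hlt : n < r ^ k := by
      obtain ⟨h, -⟩ := List.getElem?_eq_some_iff.1 hn
      rwa [length_power hlen] at h
    rw [getElem?_power hlen hr hθ _ hlt] at hn
    exact ⟨n, hlt, Option.some.inj hn⟩
  · rintro ⟨n, hn, rfl⟩
    exact ⟨n, getElem?_power hlen hr hθ _ hn⟩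

theorem exists_fixedWord_eq (hprim : IsPrimitive θ) (a b : A) : ∃ n, fixedWord θ a n = b := by
  obtain ⟨k, -, hk⟩ := hprim
  obtain ⟨n, -, hn⟩ := (mem_power_iff hlen hr hθ a b k).1 (hk a b)
  exact ⟨n, hn⟩

end FixedWord

theorem coincidenceFree_power {θ : A → List A} {r : ℕ} (hlen : ConstantLength θ r) (hr : 2 ≤ r)
    (hcf : CoincidenceFree θ r) {a b : A} {k n : ℕ} (hn : n < r ^ k)
    (h : (power θ k a)[n]? = (power θ k b)[n]?) : a = b := by
  induction k generalizing n with
  | zero =>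
    have : n = 0 := by simpa using hn
    subst this
    simpa [power] using h
  | succ k ih =>
    have hi : n % r < r := Nat.mod_lt _ (by omega)
    have hq : n / r < r ^ k := Nat.div_lt_of_lt_mul (by rwa [← pow_succ'])
    rw [← Nat.div_add_mod n r, getElem?_power_succ hlen _ _ _ _ hi,
      getElem?_power_succ hlen _ _ _ _ hi] at h
    have ha : n / r < (power θ k a).length := by rwa [length_power hlen]
    have hb : n / r < (power θ k b).length := by rwa [length_power hlen]
    rw [List.getElem?_eq_getElem ha, List.getElem?_eq_getElem hb, Option.bind_some,
      Option.bind_some] at h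
    apply ih hq
    rw [List.getElem?_eq_getElem ha, List.getElem?_eq_getElem hb]
    by_contra hne
    exact hcf _ _ (fun e => hne (congrArg some e)) _ hi h

theorem Canonical.headFixing {θ : A → List A} (hcan : Canonical θ) : HeadFixing θ := fun a => by
  rw [← List.head?_eq_getElem?]
  exact (hcan a).1

theorem Canonical.getElem?_last {θ : A → List A} {r : ℕ} (hlen : ConstantLength θ r)
    (hcan : Canonical θ) (a : A) : (θ a)[r - 1]? = some a := by
  rw [← (hcan a).2, List.getLast?_eq_getElem?, hlen]

/-- For `r = 0` no image could contain its own first letter; for `r = 1` the constant words would be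
periodic fixed words. -/
theorem two_le_of_admissible {θ : A → List A} {r : ℕ} (hlen : ConstantLength θ r)
    (hadm : Admissible θ r) (hcan : Canonical θ) (a : A) : 2 ≤ r := by
  by_contra hlt
  have h0 : r ≠ 0 := by
    rintro rfl
    have := hcan.headFixing a
    rw [List.getElem?_eq_none (by rw [hlen])] at this
    simp at this
  have h1 : r = 1 := by omega
  subst h1
  refine hadm.2 (fun _ => a) (fun n i hi => ?_) ⟨1, le_rfl, fun _ => rfl⟩
  have : i = 0 := by omega
  subst this
  exact hcan.headFixing a

/-! ### Height and the types of letters -/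

theorem primeToPart_dvd (r n : ℕ) : primeToPart r n ∣ n := by
  rcases eq_or_ne n 0 with rfl | hn
  · exact dvd_zero _
  · conv_rhs => rw [← Nat.prod_primeFactorsList hn]
    exact List.filter_sublist.prod_dvd_prod

theorem primeToPart_ne_zero (r n : ℕ) : primeToPart r n ≠ 0 := by
  rw [primeToPart, Ne, List.prod_eq_zero_iff]
  intro h
  exact (Nat.prime_of_mem_primeFactorsList (List.mem_of_mem_filter h)).ne_zero rfl

instance (θ : A → List A) (o : A) (r : ℕ) : NeZero (height θ o r) := ⟨primeToPart_ne_zero _ _⟩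

/-- The index `p` modulo the height of the class `S_p` containing a letter. -/
noncomputable def letterType (θ : A → List A) (o : A) (r : ℕ) (a : A) : ZMod (height θ o r) :=
  -(firstOcc θ o a : ZMod (height θ o r))

theorem mem_letterClass_iff {θ : A → List A} {o : A} {r p : ℕ} {a : A} :
    a ∈ letterClass θ o r p ↔ letterType θ o r a = (p : ZMod (height θ o r)) := by
  rw [letterClass, Set.mem_ofPred_eq, ← ZMod.intCast_eq_intCast_iff, letterType]
  push_cast
  exact neg_eq_iff_eq_neg.symm

section Height

variable {θ : A → List A} {r : ℕ} (hlen : ConstantLength θ r) (hr : 2 ≤ r) (hcan : Canonical θ)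
include hlen hr hcan

theorem fixedWord_mul_sub_one (a : A) (n : ℕ) :
    fixedWord θ a (r * n + (r - 1)) = fixedWord θ a n := by
  have h := isFixedWord_fixedWord hlen hr hcan.headFixing a n (r - 1) (by omega)
  rw [hcan.getElem?_last hlen] at h
  exact (Option.some.inj h).symm

theorem height_dvd_of_fixedWord_eq {o : A} {n : ℕ} (hn : fixedWord θ o n = o) :
    height θ o r ∣ n := by
  rcases Nat.eq_zero_or_pos n with rfl | h0
  · exact dvd_zero _
  have hθ := hcan.headFixing
  have hret : ∀ n, 1 ≤ n → fixedWord θ o n = o → n ∈ returnSet θ o := fun n h0 hn =>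
    ⟨h0, n, by rw [getElem?_power hlen hr hθ o (Nat.lt_pow_self (by omega)), hn]⟩
  have h1 : r - 1 ∈ returnSet θ o := by
    apply hret _ (by omega)
    have := fixedWord_mul_sub_one hlen hr hcan o 0
    rw [fixedWord_zero] at this
    simpa using this
  -- The supremum is attained, and is not a default value, because `r - 1` is a return position and
  -- bounds all common divisors.
  have h2 : returnGcd θ o ∈ {d : ℕ | ∀ n ∈ returnSet θ o, d ∣ n} :=
    Nat.sSup_mem ⟨1, fun n _ => one_dvd n⟩
      ⟨r - 1, fun d hd => Nat.le_of_dvd (by omega) (hd _ h1)⟩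
  exact (primeToPart_dvd _ _).trans (h2 n (hret n h0 hn))

theorem length_eq_one_mod_height (o : A) : (r : ZMod (height θ o r)) = 1 := by
  have h : fixedWord θ o (r - 1) = o := by
    have := fixedWord_mul_sub_one hlen hr hcan o 0
    rw [fixedWord_zero] at this
    simpa using this
  have h := (ZMod.natCast_eq_zero_iff _ _).2 (height_dvd_of_fixedWord_eq hlen hr hcan h)
  rw [Nat.cast_sub (by omega), Nat.cast_one] at h
  exact sub_eq_zero.1 h

/-- If `o` occurs at position `i` of the word generated by `u_n`, it occurs at `r^k n + i` in `u`,
so `m` divides that number, which is `n + i` modulo `m`. -/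
theorem letterType_fixedWord_self (hprim : IsPrimitive θ) (o : A) (n : ℕ) :
    letterType θ o r (fixedWord θ o n) = (n : ZMod (height θ o r)) := by
  have hθ := hcan.headFixing
  have hmem : firstOcc θ o (fixedWord θ o n) ∈
      {i | ∃ k, (power θ k (fixedWord θ o n))[i]? = some o} := by
    apply Nat.sInf_mem
    obtain ⟨i, hi⟩ := exists_fixedWord_eq hlen hr hθ hprim (fixedWord θ o n) o
    exact ⟨i, i, by rw [getElem?_power hlen hr hθ _ (Nat.lt_pow_self (by omega)), hi]⟩
  obtain ⟨k, hk⟩ := hmem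
  have hlt : firstOcc θ o (fixedWord θ o n) < r ^ k := by
    obtain ⟨h, -⟩ := List.getElem?_eq_some_iff.1 hk
    rwa [length_power hlen] at h
  rw [power_fixedWord hlen hr hθ _ _ _ _ hlt] at hk
  have h := (ZMod.natCast_eq_zero_iff _ _).2
    (height_dvd_of_fixedWord_eq hlen hr hcan (Option.some.inj hk))
  push_cast at h
  rw [length_eq_one_mod_height hlen hr hcan, one_pow, one_mul] at h
  rw [letterType]
  exact (eq_neg_of_add_eq_zero_left h).symm

theorem letterType_fixedWord (hprim : IsPrimitive θ) (o a : A) (n : ℕ) :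
    letterType θ o r (fixedWord θ a n) = letterType θ o r a + (n : ZMod (height θ o r)) := by
  have hθ := hcan.headFixing
  obtain ⟨n₀, rfl⟩ := exists_fixedWord_eq hlen hr hθ hprim o a
  rw [fixedWord_fixedWord hlen hr hθ o n₀ n n (Nat.lt_pow_self (by omega)),
    letterType_fixedWord_self hlen hr hcan hprim, letterType_fixedWord_self hlen hr hcan hprim]
  push_cast
  rw [length_eq_one_mod_height hlen hr hcan, one_pow, one_mul]

end Height

/-! ### Classes of legal two-letter words -/

theorem pair_infix_iff {x y : A} {l : List A} :
    [x, y] <:+: l ↔ ∃ n, l[n]? = some x ∧ l[n + 1]? = some y := by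
  constructor
  · rintro ⟨s, t, rfl⟩
    exact ⟨s.length, by simp, by simp⟩
  · rintro ⟨n, hx, hy⟩
    obtain ⟨h0, rfl⟩ := List.getElem?_eq_some_iff.1 hx
    obtain ⟨h1, rfl⟩ := List.getElem?_eq_some_iff.1 hy
    refine ⟨l.take n, l.drop (n + 2), ?_⟩
    conv_rhs => rw [← List.take_append_drop n l, List.drop_eq_getElem_cons h0,
      List.drop_eq_getElem_cons h1]
    simp

section FixedWord

variable {θ : A → List A} {r : ℕ} (hlen : ConstantLength θ r) (hr : 2 ≤ r) (hθ : HeadFixing θ)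
include hlen hr hθ

theorem fixedWord_pair_mem (a : A) (n : ℕ) :
    (fixedWord θ a n, fixedWord θ a (n + 1)) ∈ legalPairs θ := by
  have h : n + 1 < r ^ (n + 1) := Nat.lt_pow_self (by omega)
  exact ⟨n + 1, a, pair_infix_iff.2 ⟨n, getElem?_power hlen hr hθ a (by omega),
    getElem?_power hlen hr hθ a h⟩⟩

theorem exists_of_mem_legalPairs (hprim : IsPrimitive θ) (a : A) {w : A × A}
    (hw : w ∈ legalPairs θ) : ∃ n, w = (fixedWord θ a n, fixedWord θ a (n + 1)) := by
  obtain ⟨k, c, hc⟩ := hw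
  obtain ⟨j, h0, h1⟩ := pair_infix_iff.1 hc
  obtain ⟨q, rfl⟩ := exists_fixedWord_eq hlen hr hθ hprim a c
  have hlt : j + 1 < r ^ k := by
    obtain ⟨h, -⟩ := List.getElem?_eq_some_iff.1 h1
    rwa [length_power hlen] at h
  rw [power_fixedWord hlen hr hθ _ _ _ _ hlt] at h1
  rw [power_fixedWord hlen hr hθ _ _ _ _ (by omega)] at h0
  exact ⟨r ^ k * q + j, Prod.ext (Option.some.inj h0).symm (Option.some.inj h1).symm⟩

end FixedWord

/-- Covering makes the identifying relation reflexive and disjointness makes it transitive, so the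
quotient identifies nothing further. -/
theorem pairClass_eq_iff {θ : A → List A} {o : A} {r : ℕ} (hpart : PairPartition θ o r)
    {v w : legalPairs θ} : pairClass θ o r v = pairClass θ o r w ↔
      ∃ C ∈ pairFamily θ o r, v.1 ∈ C ∧ w.1 ∈ C := by
  refine ⟨fun h => ?_, fun h => Quot.sound h⟩
  have heq : Equivalence fun v w : legalPairs θ =>
      ∃ C ∈ pairFamily θ o r, v.1 ∈ C ∧ w.1 ∈ C := by
    refine ⟨fun v => ?_, fun ⟨C, hC, h1, h2⟩ => ⟨C, hC, h2, h1⟩, ?_⟩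
    · have : v.1 ∈ ⋃₀ pairFamily θ o r := by rw [hpart.2.2]; exact v.2
      obtain ⟨C, hC, hv⟩ := this
      exact ⟨C, hC, hv, hv⟩
    · rintro x y z ⟨C, hC, h1, h2⟩ ⟨D, hD, h3, h4⟩
      obtain rfl : C = D := by
        by_contra hne
        exact Set.disjoint_left.1 (hpart.2.1 hC hD hne) h2 h3
      exact ⟨C, hC, h1, h4⟩
  exact heq.eqvGen_iff.1 (Quot.eqvGen_exact h)

section Classes

variable {θ : A → List A} {o : A} {r : ℕ} (hlen : ConstantLength θ r) (hr : 2 ≤ r)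
  (hcan : Canonical θ)
include hlen hr hcan

theorem mem_pairSet_iff {i j k : ℕ} (hj : j + 2 ≤ r ^ k) {w : A × A} :
    w ∈ pairSet θ o r i j k ↔ ∃ p, letterType θ o r p = i ∧
      w = (fixedWord θ p j, fixedWord θ p (j + 1)) := by
  have hθ := hcan.headFixing
  simp only [pairSet, Set.mem_ofPred_eq, mem_letterClass_iff]
  refine exists_congr fun p => and_congr_right fun _ => ?_
  rw [getElem?_power hlen hr hθ _ (by omega), getElem?_power hlen hr hθ _ (by omega),
    Option.some_inj, Option.some_inj, Prod.ext_iff, eq_comm, eq_comm (a := w.2)]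

/-- In `P(i,j,k)` every second letter has type `i + j + 1`. This is what makes the choice of a last
letter in `φ` harmless. -/
theorem letterType_snd_eq (hprim : IsPrimitive θ) (hpart : PairPartition θ o r)
    {v w : legalPairs θ} (h : pairClass θ o r v = pairClass θ o r w) :
    letterType θ o r v.1.2 = letterType θ o r w.1.2 := by
  obtain ⟨C, ⟨i, j, k, hi, hk, hj, rfl⟩, hv, hw⟩ := (pairClass_eq_iff hpart).1 h
  obtain ⟨p, hp, hv⟩ := (mem_pairSet_iff hlen hr hcan hj).1 hv
  obtain ⟨q, hq, hw⟩ := (mem_pairSet_iff hlen hr hcan hj).1 hw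
  rw [hv, hw, letterType_fixedWord hlen hr hcan hprim, letterType_fixedWord hlen hr hcan hprim,
    hp, hq]

/-- Both words sit in the same two columns of some `θ^k(p)` and `θ^k(q)`; agreement in either column
forces `p = q`. -/
theorem fst_eq_iff_snd_eq (hcf : CoincidenceFree θ r) (hpart : PairPartition θ o r)
    {v w : legalPairs θ} (h : pairClass θ o r v = pairClass θ o r w) :
    v.1.1 = w.1.1 ↔ v.1.2 = w.1.2 := by
  have hθ := hcan.headFixing
  obtain ⟨C, ⟨i, j, k, hi, hk, hj, rfl⟩, hv, hw⟩ := (pairClass_eq_iff hpart).1 h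
  obtain ⟨p, hp, hv⟩ := (mem_pairSet_iff hlen hr hcan hj).1 hv
  obtain ⟨q, hq, hw⟩ := (mem_pairSet_iff hlen hr hcan hj).1 hw
  have key : ∀ n < r ^ k, fixedWord θ p n = fixedWord θ q n → p = q := fun n hn e =>
    coincidenceFree_power hlen hr hcf hn <| by
      rw [getElem?_power hlen hr hθ _ hn, getElem?_power hlen hr hθ _ hn, e]
  rw [hv, hw]
  constructor
  · intro e
    rw [key j (by omega) e]
  · intro e
    rw [key (j + 1) (by omega) e]

theorem pairClass_fixedWord_congr {a b : A} (hab : letterType θ o r a = letterType θ o r b)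
    (n : ℕ) : pairClass θ o r ⟨_, fixedWord_pair_mem hlen hr hcan.headFixing a n⟩ =
      pairClass θ o r ⟨_, fixedWord_pair_mem hlen hr hcan.headFixing b n⟩ := by
  have h : n + 1 < r ^ (n + 1) := Nat.lt_pow_self (by omega)
  refine Quot.sound ⟨pairSet θ o r (letterType θ o r a).val n (n + 1),
    ⟨_, n, n + 1, ZMod.val_lt _, by omega, by omega, rfl⟩, ?_, ?_⟩
  · exact (mem_pairSet_iff hlen hr hcan (by omega)).2 ⟨a, by simp, rfl⟩
  · exact (mem_pairSet_iff hlen hr hcan (by omega)).2 ⟨b, by simp [hab], rfl⟩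

/-! ### The substitution on classes -/

omit hr hcan in
theorem constantLength_pairSubst (hr : 1 ≤ r) : ConstantLength (pairSubst θ o r) r := fun b => by
  simp only [pairSubst, List.length_cons, List.length_ofFn]
  rw [hlen]
  omega

omit hlen hr hcan in
theorem headFixing_pairSubst : HeadFixing (pairSubst θ o r) := fun b => by simp [pairSubst]

theorem getElem?_pairSubst_succ (b : PairClass θ o r) (h : ℕ) (hh : h + 1 < r) :
    (pairSubst θ o r b)[h + 1]? = some (pairClass θ o r
      ⟨_, fixedWord_pair_mem hlen hr hcan.headFixing (lastLetter θ o r b) h⟩) := by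
  have hθ := hcan.headFixing
  have key : ∀ i (hi : i < (θ (lastLetter θ o r b)).length),
      (θ (lastLetter θ o r b))[i] = fixedWord θ (lastLetter θ o r b) i := by
    intro i hi
    have hir : i < r := by rwa [hlen] at hi
    have h := isFixedWord_fixedWord hlen hr hθ (lastLetter θ o r b) 0 i hir
    rw [fixedWord_zero, List.getElem?_eq_getElem hi] at h
    simpa using h
  have hl : h < (θ (lastLetter θ o r b)).length - 1 := by rw [hlen]; omega
  simp only [pairSubst, List.getElem?_cons_succ, List.getElem?_ofFn, hl, dif_pos,
    Option.some_inj]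
  congr 2
  exact Prod.ext (key _ _) (key _ _)

/-- Both sides are compared through position `n + 1 = r q + i`, by strong induction, according to
whether `i` vanishes. -/
theorem fixedWord_pairSubst_succ (hprim : IsPrimitive θ) (hpart : PairPartition θ o r)
    (b : PairClass θ o r) (n : ℕ) :
    fixedWord (pairSubst θ o r) b (n + 1) = pairClass θ o r
      ⟨_, fixedWord_pair_mem hlen hr hcan.headFixing (lastLetter θ o r b) n⟩ := by
  have hθ := hcan.headFixing
  have hφ : HeadFixing (pairSubst θ o r) := headFixing_pairSubst
  have hφl : ConstantLength (pairSubst θ o r) r :=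
    constantLength_pairSubst hlen (by omega)
  set a := lastLetter θ o r b
  induction n using Nat.strong_induction_on with
  | _ n ih =>
    have hi : (n + 1) % r < r := Nat.mod_lt _ (by omega)
    have e := Nat.div_add_mod (n + 1) r
    generalize (n + 1) / r = q at e
    rcases hi0 : (n + 1) % r with _ | i
    -- Here the pair straddles two blocks `θ(u_q)`, `θ(u_{q+1})`. By canonical form it consists of
    -- the last letter `u_q` and the first letter `u_{q+1}`.
    · rw [hi0, Nat.add_zero] at e
      obtain ⟨q, rfl⟩ : ∃ q', q = q' + 1 := Nat.exists_eq_succ_of_ne_zero (by rintro rfl; omega)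
      rw [show fixedWord (pairSubst θ o r) b (n + 1) = fixedWord (pairSubst θ o r) b (q + 1) by
        rw [← e, fixedWord_mul hφl hr hφ], ih q (by nlinarith)]
      congr 2
      have e' : n = r * q + (r - 1) := by rw [Nat.mul_succ] at e; omega
      refine Prod.ext ?_ ?_
      · conv_rhs => rw [e', fixedWord_mul_sub_one hlen hr hcan]
      · conv_rhs => rw [← e, fixedWord_mul hlen hr hθ]
    · rw [hi0] at e hi
      have e' : n = r * q + i := by omega
      have h1 := isFixedWord_fixedWord hφl hr hφ b q (i + 1) hi
      rw [getElem?_pairSubst_succ hlen hr hcan _ _ hi, e, Option.some_inj] at h1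
      rw [← h1]
      -- The representative of `v_q` need not end in `u_q`, but its last letter has the same type,
      -- and the class of a pair inside a block depends only on that type.
      have hty : letterType θ o r (lastLetter θ o r (fixedWord (pairSubst θ o r) b q)) =
          letterType θ o r (fixedWord θ a q) := by
        rcases q with _ | q
        · rw [fixedWord_zero, fixedWord_zero]
        · have h2 : q < n := by nlinarith
          refine letterType_snd_eq hlen hr hcan hprim hpart (v := Quot.out _)
            (w := ⟨_, fixedWord_pair_mem hlen hr hθ a q⟩) ?_
          rw [← ih q h2]
          exact Quot.out_eq _
      rw [pairClass_fixedWord_congr hlen hr hcan hty]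
      congr 2
      have hpow : ∀ j < r, fixedWord θ (fixedWord θ a q) j = fixedWord θ a (r * q + j) := by
        intro j hj
        have := fixedWord_fixedWord hlen hr hθ a q 1 j (by rwa [pow_one])
        rwa [pow_one] at this
      rw [hpow i (by omega), hpow (i + 1) hi, e', Nat.add_assoc]

theorem letterType_lastLetter_fixedWord (hprim : IsPrimitive θ) (hpart : PairPartition θ o r)
    (b : PairClass θ o r) (n : ℕ) :
    letterType θ o r (lastLetter θ o r (fixedWord (pairSubst θ o r) b n)) =
      letterType θ o r (lastLetter θ o r b) + n := by
  have hθ := hcan.headFixing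
  rcases n with _ | n
  · simp [fixedWord_zero]
  · have := letterType_snd_eq hlen hr hcan hprim hpart
      (v := Quot.out (fixedWord (pairSubst θ o r) b (n + 1)))
      (w := ⟨_, fixedWord_pair_mem hlen hr hθ (lastLetter θ o r b) n⟩)
      ((Quot.out_eq _).trans (fixedWord_pairSubst_succ hlen hr hcan hprim hpart b n))
    rw [← letterType_fixedWord hlen hr hcan hprim]
    exact this

theorem fixedWord_pairSubst_congr (hprim : IsPrimitive θ) (hpart : PairPartition θ o r)
    (b : PairClass θ o r) {k N N' : ℕ} (hN : N ≡ N' [MOD r ^ k])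
    (hm : N ≡ N' [MOD height θ o r]) (hk : ¬ r ^ k ∣ N) :
    fixedWord (pairSubst θ o r) b N = fixedWord (pairSubst θ o r) b N' := by
  have hθ := hcan.headFixing
  set a := lastLetter θ o r b
  have hlt : N % r ^ k < r ^ k := Nat.mod_lt _ (by positivity)
  have hpos : N % r ^ k ≠ 0 := fun h => hk (Nat.dvd_of_mod_eq_zero h)
  obtain ⟨h, hh⟩ := Nat.exists_eq_succ_of_ne_zero hpos
  have e := Nat.div_add_mod N (r ^ k)
  have e' := Nat.div_add_mod N' (r ^ k)
  rw [← hN] at e'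
  rw [hh] at e e' hlt
  generalize N / r ^ k = q at e
  generalize N' / r ^ k = q' at e'
  have key : ∀ q, fixedWord (pairSubst θ o r) b (r ^ k * q + (h + 1)) = pairClass θ o r
      ⟨_, fixedWord_pair_mem hlen hr hθ (fixedWord θ a q) h⟩ := by
    intro q
    rw [← Nat.add_assoc, fixedWord_pairSubst_succ hlen hr hcan hprim hpart b]
    congr 2
    rw [fixedWord_fixedWord hlen hr hθ _ _ k _ hlt,
      fixedWord_fixedWord hlen hr hθ _ _ k h (by omega), Nat.add_assoc]
  rw [← e, ← e', key, key]
  apply pairClass_fixedWord_congr hlen hr hcan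
  rw [letterType_fixedWord hlen hr hcan hprim, letterType_fixedWord hlen hr hcan hprim]
  have h := (ZMod.natCast_eq_natCast_iff _ _ _).2 hm
  rw [← e, ← e'] at h
  push_cast at h
  rw [length_eq_one_mod_height hlen hr hcan] at h
  simpa using h

theorem exists_fixedWord_pairSubst_eq (hprim : IsPrimitive θ) (hpart : PairPartition θ o r)
    (b c : PairClass θ o r) : ∃ n, fixedWord (pairSubst θ o r) b (n + 1) = c := by
  induction c using Quot.ind with
  | _ w =>
    obtain ⟨w, hw⟩ := w
    obtain ⟨n, rfl⟩ := exists_of_mem_legalPairs hlen hr hcan.headFixing hprim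
      (lastLetter θ o r b) hw
    exact ⟨n, fixedWord_pairSubst_succ hlen hr hcan hprim hpart b n⟩

/-- If `v` had period `q` from position 1 on, then `u_{n+lq} = u_n` would hold for all `n` or for
none. The pigeonhole principle on the letters `u_{sq}` then gives a period of `u`, against
admissibility. -/
theorem not_periodic_fixedWord_pairSubst [Finite A] (hadm : Admissible θ r)
    (hprim : IsPrimitive θ) (hcf : CoincidenceFree θ r) (hpart : PairPartition θ o r)
    (b : PairClass θ o r) {q : ℕ} (hq : 1 ≤ q) :
    ∃ n, fixedWord (pairSubst θ o r) b (n + 1 + q) ≠ fixedWord (pairSubst θ o r) b (n + 1) := by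
  have hθ := hcan.headFixing
  by_contra! h
  set u := fixedWord θ (lastLetter θ o r b) with hu
  have hstep : ∀ l n, fixedWord (pairSubst θ o r) b (n + 1 + l * q) =
      fixedWord (pairSubst θ o r) b (n + 1) := by
    intro l
    induction l with
    | zero => simp
    | succ l ih =>
      intro n
      refine (congrArg _ ?_).trans ((h (n + l * q)).trans ((congrArg _ ?_).trans (ih n)))
      · ring
      · ring
  have hiff : ∀ l n, u (n + l * q) = u n ↔ u (n + 1 + l * q) = u (n + 1) := by
    intro l n
    have h1 := hstep l n
    rw [show n + 1 + l * q = n + l * q + 1 by ring,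
      fixedWord_pairSubst_succ hlen hr hcan hprim hpart,
      fixedWord_pairSubst_succ hlen hr hcan hprim hpart] at h1
    have h2 := fst_eq_iff_snd_eq hlen hr hcan hcf hpart h1
    rwa [show n + 1 + l * q = n + l * q + 1 by ring]
  have hzero : ∀ l n, u (n + l * q) = u n ↔ u (l * q) = u 0 := by
    intro l n
    induction n with
    | zero => simp
    | succ n ih => rw [← hiff, ih]
  obtain ⟨s, t, hst, he⟩ := Finite.exists_ne_map_eq_of_infinite fun s : ℕ => u (s * q)
  wlog hlt : s < t generalizing s t
  · exact this t s hst.symm he.symm (by omega)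
  have hper : u ((t - s) * q) = u 0 := by
    rw [← hzero _ (s * q), ← Nat.add_mul, Nat.add_sub_cancel' hlt.le]
    exact he.symm
  refine hadm.2 u (isFixedWord_fixedWord hlen hr hθ _) ⟨(t - s) * q, ?_, fun n => ?_⟩
  · exact Nat.mul_pos (by omega) hq
  · exact (hzero _ n).2 hper

end Classes

/-! ### Digit sums -/

/-- The number `z_0 + z_1 r + … + z_{k-1} r^{k-1}`. -/
def digitSum {r : ℕ} (z : ℕ → Fin r) (k : ℕ) : ℕ := ∑ i ∈ Finset.range k, (z i : ℕ) * r ^ i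

section Digits

variable {r : ℕ} (z : ℕ → Fin r)

theorem digitSum_succ (k : ℕ) : digitSum z (k + 1) = digitSum z k + z k * r ^ k :=
  Finset.sum_range_succ _ _

theorem digitSum_lt (k : ℕ) : digitSum z k < r ^ k := by
  induction k with
  | zero => simp [digitSum]
  | succ k ih =>
    rw [digitSum_succ, pow_succ']
    have := Nat.mul_le_mul_right (r ^ k) (z k).isLt
    rw [Nat.succ_mul] at this
    omega

theorem digitSum_modEq {j k : ℕ} (hjk : j ≤ k) : digitSum z k ≡ digitSum z j [MOD r ^ j] := by
  induction k, hjk using Nat.le_induction with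
  | base => rfl
  | succ k hjk ih =>
    rw [digitSum_succ]
    have h : (z k : ℕ) * r ^ k ≡ 0 [MOD r ^ j] :=
      (Nat.modEq_zero_iff_dvd.2 ((pow_dvd_pow r hjk).mul_left _))
    exact ih.add h

theorem eq_of_digitSum_eq {z z' : ℕ → Fin r} (h : ∀ k, digitSum z k = digitSum z' k) :
    z = z' := by
  funext k
  have h1 := h (k + 1)
  rw [digitSum_succ, digitSum_succ, h k] at h1
  have hr : 0 < r ^ k := pow_pos ((Nat.zero_le _).trans_lt (z 0).isLt) k
  exact Fin.ext (Nat.eq_of_mul_eq_mul_right hr (Nat.add_left_cancel h1))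

theorem digitSum_eq_mod (N : ℕ) (k : ℕ) (h : ∀ i < k, (z i : ℕ) = N / r ^ i % r) :
    digitSum z k = N % r ^ k := by
  induction k with
  | zero => simp [digitSum, Nat.mod_one]
  | succ k ih =>
    rw [digitSum_succ, ih fun i hi => h i (by omega), h k (by omega), Nat.mod_pow_succ]
    ring

theorem digitSum_odometer_modEq (k : ℕ) :
    digitSum (odometer z) k ≡ digitSum z k + 1 [MOD r ^ k] := by
  classical
  -- The correction term `r^k` is the carry leaving the first `k` digits.
  have key : digitSum (odometer z) k + (if ∀ i < k, (z i : ℕ) + 1 = r then r ^ k else 0) =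
      digitSum z k + 1 := by
    induction k with
    | zero => simp [digitSum]
    | succ k ih =>
      rw [digitSum_succ, digitSum_succ]
      have hlt := (z k).isLt
      by_cases h : ∀ i < k, (z i : ℕ) + 1 = r
      · rw [if_pos h] at ih
        by_cases hk : (z k : ℕ) + 1 = r
        · rw [if_pos fun i hi => by rcases Nat.lt_succ_iff_lt_or_eq.1 hi with hi | rfl
                                    · exact h i hi
                                    · exact hk]
          have ho : ((odometer z k : Fin r) : ℕ) = 0 := by
            simp only [odometer, if_pos h, hk, Nat.mod_self]
          have hp : r ^ (k + 1) = z k * r ^ k + r ^ k := by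
            rw [← Nat.succ_mul, Nat.succ_eq_add_one, hk, pow_succ']
          rw [ho, hp]
          omega
        · rw [if_neg fun h' => hk (h' k (by omega))]
          have ho : ((odometer z k : Fin r) : ℕ) = z k + 1 := by
            simp only [odometer, if_pos h]
            exact Nat.mod_eq_of_lt (by omega)
          rw [ho, Nat.add_mul, Nat.one_mul]
          omega
      · rw [if_neg h] at ih
        rw [if_neg fun h' => h fun i hi => h' i (by omega)]
        have ho : odometer z k = z k := by simp only [odometer, if_neg h]
        rw [ho]
        omega
  rw [← key]
  split_ifs
  · simp [Nat.ModEq]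
  · rfl

end Digits

/-- An ultrafilter pushed to a finite type is principal. Using one fixed ultrafilter makes all
coordinates converge together, in place of diagonal subsequences. -/
theorem exists_eventually_hyperfilter_eq {α : Type*} [Finite α] (f : ℕ → α) :
    ∃ a, ∀ᶠ n in Filter.hyperfilter ℕ, f n = a := by
  obtain ⟨a, ha⟩ := ((Filter.hyperfilter ℕ).map f).eq_pure_of_finite
  refine ⟨a, ?_⟩
  have : ({a} : Set α) ∈ (Filter.hyperfilter ℕ).map f := by
    rw [ha]
    exact Set.mem_singleton a
  exact this

/-! ### Substitutions whose fixed word is determined by congruences -/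

variable {B : Type*}

/-- The right-infinite fixed word `v` of `φ` beginning with `b` contains every letter, is not
periodic after any letter, determines positions modulo `m`, and `v_N` depends only on `N` modulo
`m` and modulo any `r^k` not dividing `N`. -/
structure CongruenceGenerated (φ : B → List B) (r m : ℕ) (b : B) : Prop where
  constantLength : ConstantLength φ r
  two_le : 2 ≤ r
  headFixing : HeadFixing φ
  length_eq_one : (r : ZMod m) = 1
  congr : ∀ k N N' : ℕ, N ≡ N' [MOD r ^ k] → N ≡ N' [MOD m] → ¬ r ^ k ∣ N →
    fixedWord φ b N = fixedWord φ b N'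
  cast_eq : ∀ N N' : ℕ, fixedWord φ b N = fixedWord φ b N' → (N : ZMod m) = N'
  surj : ∀ c, ∃ n, fixedWord φ b (n + 1) = c
  not_periodic : ∀ c q, 1 ≤ q → ∃ n, fixedWord φ c (n + 1 + q) ≠ fixedWord φ c (n + 1)

/-- The two-sided word `x` is the limit of shifts of the fixed word beginning with `b` by numbers
converging to `(c, z)`. -/
def IsGeneratedBy (φ : B → List B) (r m : ℕ) (b : B) (x : ℤ → B) (c : ZMod m) (z : ℕ → Fin r) :
    Prop :=
  ∀ L k : ℕ, ∃ M : ℕ, L < M ∧ (M : ZMod m) = c ∧ M ≡ digitSum z k [MOD r ^ k] ∧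
    ∀ (n : ℕ) (i : ℤ), |i| ≤ L → (n : ℤ) = M + i → x i = fixedWord φ b n

namespace CongruenceGenerated

variable {φ : B → List B} {r m : ℕ} {b : B} (h : CongruenceGenerated φ r m b)
include h

theorem power_eq_map (a : B) (k n : ℕ) : power φ k (fixedWord φ a n) =
    (List.range (r ^ k)).map fun i => fixedWord φ a (r ^ k * n + i) := by
  apply List.ext_getElem?
  intro i
  rcases lt_or_ge i (r ^ k) with hi | hi
  · rw [power_fixedWord h.constantLength h.two_le h.headFixing _ _ _ _ hi]
    simp [hi]
  · rw [List.getElem?_eq_none (by rw [length_power h.constantLength]; omega),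
      List.getElem?_eq_none (by simpa using hi)]

/-- Let `q = m r^j` and suppose `r^j ∤ N`. Then each position `i` of the block is a non-multiple of
`r^j` in at least one of its two occurrences in `v`: at `N + i`, or at `r^k (n + 1) + i` where
`v_{n+1} = a`. Moving by `q` there leaves the letter unchanged, so the block would have period `q`,
which fails once it is long enough. -/
theorem exists_recognition_level [Finite B] [NeZero m] (j : ℕ) : ∃ K, j ≤ K ∧ ∀ k, K ≤ k →
    ∀ (N : ℕ) (a : B), (∀ i < r ^ k, fixedWord φ b (N + i) = fixedWord φ a i) → r ^ j ∣ N := by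
  have hr := h.two_le
  have hm : 0 < m := NeZero.pos m
  set q := m * r ^ j with hq
  choose g hg using fun a => h.not_periodic a q (Nat.mul_pos hm (by positivity))
  have : Fintype B := Fintype.ofFinite B
  -- The sum serves as a common bound for the positions `g a` at which period `q` fails.
  refine ⟨j + (∑ a, g a + q + 1), by omega, fun k hk N a hN => ?_⟩
  by_contra hdvd
  have hga : g a ≤ ∑ a, g a := Finset.single_le_sum (fun _ _ => Nat.zero_le _) (Finset.mem_univ a)
  have hlt : g a + 1 + q < r ^ k :=
    lt_of_le_of_lt (by omega) (Nat.lt_pow_self (n := k) (by omega : 1 < r))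
  refine hg a ?_
  have hqm : q ≡ 0 [MOD m] := Nat.modEq_zero_iff_dvd.2 (Dvd.intro _ rfl)
  have hqj : q ≡ 0 [MOD r ^ j] := Nat.modEq_zero_iff_dvd.2 (Dvd.intro_left _ rfl)
  by_cases hi : r ^ j ∣ g a + 1
  · rw [← hN _ hlt, ← hN _ (by omega), ← Nat.add_assoc]
    refine (h.congr j _ _ ?_ ?_ ?_).symm
    · exact (hqj.symm.add_left (N + (g a + 1)))
    · exact (hqm.symm.add_left (N + (g a + 1)))
    · exact fun h' => hdvd ((Nat.dvd_add_left hi).1 h')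
  · obtain ⟨n, rfl⟩ := h.surj a
    have hjk : r ^ j ∣ r ^ k * (n + 1) := (pow_dvd_pow r (by omega)).mul_right _
    rw [fixedWord_fixedWord h.constantLength h.two_le h.headFixing _ _ k _ hlt,
      fixedWord_fixedWord h.constantLength h.two_le h.headFixing _ _ k _ (by omega),
      ← Nat.add_assoc]
    refine (h.congr j _ _ ?_ ?_ ?_).symm
    · exact hqj.symm.add_left _
    · exact hqm.symm.add_left _
    · exact fun h' => hi ((Nat.dvd_add_right hjk).1 h')

/-! ### Points of the shift space as limits of shifts of the fixed word -/

theorem mem_space {x : ℤ → B} {c : ZMod m} {z : ℕ → Fin r} (hx : IsGeneratedBy φ r m b x c z) :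
    x ∈ space φ := by
  intro s L
  obtain ⟨M, hM, -, -, hx⟩ := hx (s.natAbs + L) 0
  have hr := h.two_le
  obtain ⟨N, hN⟩ : ∃ N : ℕ, (N : ℤ) = M + s := ⟨(M + s).toNat, by omega⟩
  refine ⟨N + L, b, ?_⟩
  have hlt : N + L < r ^ (N + L) := Nat.lt_pow_self (by omega)
  have hpow := h.power_eq_map b (N + L) 0
  rw [fixedWord_zero] at hpow
  have hw : window x s L = ((power φ (N + L) b).drop N).take L := by
    apply List.ext_getElem?
    intro i
    rw [List.getElem?_take, List.getElem?_drop, hpow]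
    split_ifs with hi
    · have : N + i < r ^ (N + L) := by omega
      simp only [window, List.getElem?_map, List.getElem?_range hi, List.getElem?_range this,
        Option.map_some, Option.some_inj]
      rw [hx (N + i) (s + i) (by rw [abs_le]; omega) (by push_cast; omega)]
      simp
    · exact List.getElem?_eq_none (by simpa [window] using hi)
  rw [hw]
  exact (List.take_prefix _ _).isInfix.trans (List.drop_suffix _ _).isInfix

theorem exists_shift {x : ℤ → B} (hx : x ∈ space φ) (L : ℕ) : ∃ M : ℕ, L < M ∧
    ∀ (n : ℕ) (i : ℤ), |i| ≤ L → (n : ℤ) = M + i → x i = fixedWord φ b n := by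
  have hr := h.two_le
  obtain ⟨k, a, s, t, hst⟩ := hx (-L) (2 * L + 1)
  -- An occurrence of `a` at a positive position `q + 1` makes the centre of the window lie beyond
  -- `L`.
  obtain ⟨q, rfl⟩ := h.surj a
  rw [h.power_eq_map] at hst
  have hpos : 0 < r ^ k := by positivity
  have hpos' : 0 < r ^ k * (q + 1) := by positivity
  refine ⟨r ^ k * (q + 1) + s.length + L, by omega, fun n i hi hn => ?_⟩
  rw [abs_le] at hi
  obtain ⟨e, he⟩ : ∃ e : ℕ, (e : ℤ) = i + L := ⟨(i + L).toNat, by omega⟩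
  have hlen := congrArg List.length hst
  simp only [List.length_append, window, List.length_map, List.length_range] at hlen
  have h1 := congrArg (fun l : List B => l[s.length + e]?) hst
  have he' : e < 2 * L + 1 := by omega
  simp only [List.append_assoc] at h1
  rw [List.getElem?_append_right (by omega), List.getElem?_append_left (by simp [window]; omega)]
    at h1
  have h2 : s.length + e < r ^ k := by omega
  simp only [window, List.getElem?_map, Nat.add_sub_cancel_left, List.getElem?_range he',
    List.getElem?_range h2, Option.map_some, Option.some_inj] at h1
  rw [show i = -(L : ℤ) + e by omega, h1]
  congr 1
  push_cast at hn
  zify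
  omega

theorem exists_isGeneratedBy_of_mem [NeZero m] {x : ℤ → B} (hx : x ∈ space φ) :
    ∃ c z, IsGeneratedBy φ r m b x c z := by
  have hr := h.two_le
  choose M hM hxM using h.exists_shift hx
  obtain ⟨c, hc⟩ := exists_eventually_hyperfilter_eq fun n => (M n : ZMod m)
  choose z hz using fun i => exists_eventually_hyperfilter_eq fun n => (⟨M n / r ^ i % r, Nat.mod_lt _ (by omega)⟩ : Fin r)
  refine ⟨c, z, fun L k => ?_⟩
  have hz' : ∀ᶠ n in Filter.hyperfilter ℕ, ∀ i ∈ Finset.range k,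
      (⟨M n / r ^ i % r, Nat.mod_lt _ (by omega)⟩ : Fin r) = z i :=
    (Filter.eventually_all_finset _).2 fun i _ => hz i
  obtain ⟨n, hn1, hn2, hn3⟩ := (hc.and (hz'.and
    ((Filter.eventually_ge_atTop L).filter_mono Nat.hyperfilter_le_atTop))).exists
  refine ⟨M n, hn3.trans_lt (hM n), hn1, ?_, fun N i hi hN => hxM n N i ?_ hN⟩
  · rw [digitSum_eq_mod z (M n) k fun i hi => by rw [← hn2 i (Finset.mem_range.2 hi)]]
    exact (Nat.mod_modEq _ _).symm
  · exact hi.trans (by exact_mod_cast hn3)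

/-- As `r ≡ 1` modulo `m`, the moduli `m` and `r^n` are coprime, so integers `M n` converging to
`(c, z)` exist; `x` is a limit of the corresponding shifts. -/
theorem exists_isGeneratedBy [Finite B] [NeZero m] (c : ZMod m) (z : ℕ → Fin r) :
    ∃ x, IsGeneratedBy φ r m b x c z := by
  have hr := h.two_le
  have hcop : r.Coprime m := by
    rw [← ZMod.isUnit_iff_coprime, h.length_eq_one]
    exact isUnit_one
  have hM : ∀ n, ∃ M : ℕ, n < M ∧ (M : ZMod m) = c ∧ M ≡ digitSum z n [MOD r ^ n] := by
    intro n
    obtain ⟨M, h1, h2⟩ := Nat.chineseRemainder (hcop.symm.pow_right n) c.val (digitSum z n)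
    have hpos : 0 < m * r ^ n := Nat.mul_pos (NeZero.pos m) (by positivity)
    -- The added multiple of both moduli pushes the solution beyond `n`.
    refine ⟨M + m * r ^ n * (n + 1), by nlinarith, ?_, ?_⟩
    · have := (ZMod.natCast_eq_natCast_iff _ _ _).2 h1
      rw [ZMod.natCast_zmod_val] at this
      simp [this]
    · refine Nat.ModEq.trans ?_ h2
      have : m * r ^ n * (n + 1) ≡ 0 [MOD r ^ n] :=
        Nat.modEq_zero_iff_dvd.2 ((Dvd.intro_left _ rfl).mul_right _)
      exact this.add_left M
  choose M hM1 hM2 hM3 using hM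
  choose x hx using fun i : ℤ => exists_eventually_hyperfilter_eq fun n => fixedWord φ b (M n + i).toNat
  refine ⟨x, fun L k => ?_⟩
  have hx' : ∀ᶠ n in Filter.hyperfilter ℕ, ∀ i ∈ Finset.Icc (-L : ℤ) L,
      fixedWord φ b (M n + i).toNat = x i :=
    (Filter.eventually_all_finset _).2 fun i _ => hx i
  obtain ⟨n, hn1, hn2⟩ := (hx'.and ((Filter.eventually_ge_atTop (L + k)).filter_mono
    Nat.hyperfilter_le_atTop)).exists
  refine ⟨M n, by have := hM1 n; omega, hM2 n, ?_, fun N i hi hN => ?_⟩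
  · exact ((hM3 n).of_dvd (pow_dvd_pow r (by omega))).trans (digitSum_modEq z (by omega))
  · rw [← hn1 i (Finset.mem_Icc.2 (abs_le.1 hi)), ← hN, Int.toNat_natCast]

/-! ### Reading the phase and the address off a generated point -/

theorem isPhase [NeZero m] {x : ℤ → B} {c : ZMod m} {z : ℕ → Fin r}
    (hx : IsGeneratedBy φ r m b x c z) : IsPhase b m x c := by
  classical
  have hr := h.two_le
  have hm : 0 < m := NeZero.pos m
  obtain ⟨n, hn⟩ := h.surj b
  have hlt : n + 1 < r ^ (n + 1) := Nat.lt_pow_self (by omega)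
  -- Since `r^(n+1)` does not divide `n + 1`, the letter `b` stands at every position of `v`
  -- congruent to `n + 1` modulo `D`.
  set D := m * r ^ (n + 1) with hD
  have hex : ∃ p : ℕ, 1 ≤ p ∧ x p = b := by
    obtain ⟨M, hM, -, -, hx⟩ := hx D 0
    have hDpos : 0 < D := by positivity
    -- The remainder is that of `M - (n + 1)`, written without subtraction; so this `p` lies in `[1,
    -- D]` and `M + p ≡ n + 1` modulo `D`.
    refine ⟨D - (M + (D - 1) * (n + 1)) % D, ?_, ?_⟩
    · have := Nat.mod_lt (M + (D - 1) * (n + 1)) hDpos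
      omega
    · set e := (M + (D - 1) * (n + 1)) % D with he
      have hle : e < D := Nat.mod_lt _ hDpos
      rw [hx (M + (D - e)) _ (by rw [abs_le]; omega) (by push_cast; ring)]
      refine Eq.trans ?_ hn
      have hcong : n + 1 ≡ M + (D - e) [MOD D] := by
        have h1 : M + (D - 1) * (n + 1) ≡ e [MOD D] := (Nat.mod_modEq _ _).symm
        have h2 : M + (D - e) + e ≡ n + 1 + e [MOD D] := by
          refine Nat.ModEq.trans ?_ (h1.add_left (n + 1))
          have h3 : n + 1 + (M + (D - 1) * (n + 1)) = M + D * (n + 1) := by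
            obtain ⟨d, hd⟩ := Nat.exists_eq_succ_of_ne_zero hDpos.ne'
            rw [hd]
            simp only [Nat.succ_sub_one, Nat.succ_eq_add_one]
            ring
          rw [h3, Nat.add_assoc, Nat.sub_add_cancel hle.le]
          simp [Nat.ModEq]
        exact (Nat.ModEq.add_right_cancel' e h2).symm
      refine (h.congr (n + 1) _ _ (hcong.of_dvd (Dvd.intro_left _ rfl))
        (hcong.of_dvd (Dvd.intro _ rfl)) ?_).symm
      exact fun h' => absurd (Nat.le_of_dvd (by omega) h') (by omega)
  obtain ⟨p, hp⟩ : ∃ p : ℕ, IsLeast {i : ℕ | 1 ≤ i ∧ x i = b} p :=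
    ⟨Nat.find hex, Nat.find_spec hex, fun i hi => Nat.find_min' hex hi⟩
  refine ⟨p, hp, ?_⟩
  obtain ⟨M, hM, hc, -, hx⟩ := hx p 0
  have h1 := hx (M + p) p (by simp) (by push_cast; ring)
  rw [hp.1.2] at h1
  -- The letter `b` is also `v_0`, so `M + p ≡ 0` modulo `m`.
  have h2 := h.cast_eq 0 (M + p) (by rw [fixedWord_zero]; exact h1)
  push_cast at h2
  rw [hc] at h2
  exact eq_neg_of_add_eq_zero_left h2.symm

/-- The window starts in `v` at `M` minus the digit sum, a multiple `r^(k+1) q`, hence is the block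
of `v_q`. -/
theorem isAddress {x : ℤ → B} {c : ZMod m} {z : ℕ → Fin r}
    (hx : IsGeneratedBy φ r m b x c z) : IsAddress φ r x z := by
  intro k _
  have hr := h.two_le
  obtain ⟨M, hM, -, hz, hx⟩ := hx (r ^ (k + 1)) (k + 1)
  have hs := digitSum_lt z (k + 1)
  have hdvd := (Nat.modEq_iff_dvd' (by omega)).1 hz.symm
  obtain ⟨q, hq⟩ := hdvd
  refine ⟨fixedWord φ b q, ?_⟩
  have hsum : (∑ i ∈ Finset.range (k + 1), ((z i : ℕ) : ℤ) * (r : ℤ) ^ i) =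
      (digitSum z (k + 1) : ℤ) := by
    simp [digitSum]
  rw [h.power_eq_map, hsum, window]
  apply List.map_congr_left
  intro i hi
  rw [List.mem_range] at hi
  refine hx _ _ (by rw [abs_le]; zify at hs hi ⊢; omega) ?_
  rw [← hq]
  push_cast [Nat.cast_sub (show digitSum z (k + 1) ≤ M by omega)]
  ring

/-- By recognition, the blocks prescribed by `z'` start in `v` at multiples of `r^j`; this forces
the digit sums of `z'` and `z` to agree modulo every `r^j`. -/
theorem address_unique [Finite B] [NeZero m] {x : ℤ → B} {c : ZMod m} {z z' : ℕ → Fin r}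
    (hx : IsGeneratedBy φ r m b x c z) (hz' : IsAddress φ r x z') : z' = z := by
  have hr := h.two_le
  refine eq_of_digitSum_eq fun j => ?_
  obtain ⟨K, hjK, hK⟩ := h.exists_recognition_level j
  set k := K + 1 with hk
  obtain ⟨M, hM, -, hz, hx⟩ := hx (r ^ (k + 1)) (k + 1)
  obtain ⟨a, ha⟩ := hz' k (by omega)
  have hs := digitSum_lt z' (k + 1)
  have hsum : (∑ i ∈ Finset.range (k + 1), ((z' i : ℕ) : ℤ) * (r : ℤ) ^ i) =
      (digitSum z' (k + 1) : ℤ) := by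
    simp [digitSum]
  rw [hsum] at ha
  have hdvd : r ^ j ∣ M - digitSum z' (k + 1) := by
    refine hK (k + 1) (by omega) _ a fun i hi => ?_
    have h1 := congrArg (fun l : List B => l[i]?) ha
    simp only [window, List.getElem?_map, List.getElem?_range hi, Option.map_some] at h1
    rw [getElem?_power h.constantLength h.two_le h.headFixing _ hi, Option.some_inj] at h1
    rw [← h1]
    refine (hx _ _ (by rw [abs_le]; zify at hs hi ⊢; omega) ?_).symm
    push_cast [Nat.cast_sub (show digitSum z' (k + 1) ≤ M by omega)]
    ring
  have h1 : digitSum z' (k + 1) ≡ M [MOD r ^ j] := (Nat.modEq_iff_dvd' (by omega)).2 hdvd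
  have h2 : digitSum z' j ≡ digitSum z j [MOD r ^ j] :=
    (digitSum_modEq z' (by omega)).symm.trans
      (h1.trans ((hz.of_dvd (pow_dvd_pow r (by omega))).trans (digitSum_modEq z (by omega))))
  have h3 := digitSum_lt z' j
  have h4 := digitSum_lt z j
  exact Nat.ModEq.eq_of_lt_of_lt h2 h3 h4

theorem isGeneratedBy_iff [Finite B] [NeZero m] {x : ℤ → B} (hx : x ∈ space φ) {c : ZMod m}
    {z : ℕ → Fin r} : IsGeneratedBy φ r m b x c z ↔ IsPhase b m x c ∧ IsAddress φ r x z := by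
  refine ⟨fun hg => ⟨h.isPhase hg, h.isAddress hg⟩, fun ⟨⟨p, hp, hc⟩, hz⟩ => ?_⟩
  obtain ⟨c', z', hg⟩ := h.exists_isGeneratedBy_of_mem hx
  obtain ⟨p', hp', hc'⟩ := h.isPhase hg
  obtain rfl : z = z' := h.address_unique hg hz
  obtain rfl : c = c' := by rw [hc, hc', hp.unique hp']
  exact hg

/-! ### Equivariance and injectivity off the orbits of fixed points -/

omit h in
theorem _root_.Subst.IsGeneratedBy.shift {x : ℤ → B} {c : ZMod m} {z : ℕ → Fin r}
    (hx : IsGeneratedBy φ r m b x c z) : IsGeneratedBy φ r m b (shift x) (c + 1) (odometer z) := by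
  intro L k
  obtain ⟨M, hM, hc, hz, hx⟩ := hx (L + 1) k
  refine ⟨M + 1, by omega, by push_cast; rw [hc], ?_, fun n i hi hn => ?_⟩
  · exact (hz.add_right 1).trans (digitSum_odometer_modEq z k).symm
  · exact hx n (i + 1) (by rw [abs_le] at hi ⊢; push_cast; omega) (by push_cast at hn; omega)

theorem eq_or_mem_orbit {x y : ℤ → B} {c : ZMod m} {z : ℕ → Fin r}
    (hx : IsGeneratedBy φ r m b x c z) (hy : IsGeneratedBy φ r m b y c z) :
    x = y ∨ ∃ w, IsFixedPoint φ r w ∧ x ∈ orbit w := by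
  have hr := h.two_le
  -- The alternative is whether `-z` is an ordinary integer in `ℤ(r)`; if it is not, every `x_n` is
  -- determined by `congr`.
  by_cases hall : ∀ n : ℤ, ∃ k, ¬ ((r ^ k : ℕ) : ℤ) ∣ n + digitSum z k
  · left
    funext n
    obtain ⟨k, hk⟩ := hall n
    obtain ⟨M, hM, hMc, hMz, hx⟩ := hx n.natAbs k
    obtain ⟨M', hM', hMc', hMz', hy⟩ := hy n.natAbs k
    have hn : |n| ≤ n.natAbs := by simp
    obtain ⟨N, hN⟩ : ∃ N : ℕ, (N : ℤ) = M + n := ⟨(M + n).toNat, by omega⟩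
    obtain ⟨N', hN'⟩ : ∃ N : ℕ, (N : ℤ) = M' + n := ⟨(M' + n).toNat, by omega⟩
    rw [hx N n hn hN, hy N' n hn hN']
    have hmod : ∀ d : ℕ, M ≡ M' [MOD d] → N ≡ N' [MOD d] := by
      intro d hd
      rw [← Int.natCast_modEq_iff] at hd ⊢
      rw [hN, hN']
      exact hd.add_right n
    refine h.congr k N N' (hmod _ (hMz.trans hMz'.symm)) (hmod _ ?_) fun hdvd => hk ?_
    · rw [← ZMod.natCast_eq_natCast_iff, hMc, hMc']
    · have h1 : ((r ^ k : ℕ) : ℤ) ∣ N := by exact_mod_cast hdvd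
      rw [hN] at h1
      have h2 : ((r ^ k : ℕ) : ℤ) ∣ (digitSum z k : ℤ) - M :=
        (Int.natCast_modEq_iff.2 hMz).dvd
      have h3 := dvd_add h1 h2
      rwa [show (M : ℤ) + n + (digitSum z k - M) = n + digitSum z k by ring] at h3
  · right
    push Not at hall
    obtain ⟨n, hn⟩ := hall
    refine ⟨fun i => x (i + n), ?_, -n, fun i => by simp⟩
    intro t i hi
    obtain ⟨k, hk⟩ : ∃ k : ℕ, t.natAbs < r ^ k := ⟨_, Nat.lt_pow_self (by omega)⟩
    obtain ⟨M, hM, -, hMz, hx⟩ :=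
      hx (n.natAbs + t.natAbs + ((r : ℤ) * t).natAbs + i) (k + 1)
    obtain ⟨P, hP⟩ : ∃ P : ℕ, (P : ℤ) = M + n := ⟨(M + n).toNat, by omega⟩
    obtain ⟨Q, rfl⟩ : r ^ (k + 1) ∣ P := by
      have h1 := hn (k + 1)
      have h2 : ((r ^ (k + 1) : ℕ) : ℤ) ∣ (M : ℤ) - digitSum z (k + 1) :=
        (Int.natCast_modEq_iff.2 hMz.symm).dvd
      have h3 := dvd_add h1 h2
      rw [show n + (digitSum z (k + 1) : ℤ) + (M - digitSum z (k + 1)) = M + n by ring,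
        ← hP] at h3
      exact_mod_cast h3
    rw [pow_succ', Nat.mul_assoc] at hP
    have hQ : 0 < Q := by
      rcases Nat.eq_zero_or_pos Q with rfl | hQ
      · simp at hP
        omega
      · exact hQ
    have hkQ : r ^ k ≤ r ^ k * Q := Nat.le_mul_of_pos_right _ hQ
    obtain ⟨N, hN⟩ : ∃ N : ℕ, (N : ℤ) = ((r ^ k * Q : ℕ) : ℤ) + t :=
      ⟨(((r ^ k * Q : ℕ) : ℤ) + t).toNat, by omega⟩
    obtain ⟨N', hN'⟩ : ∃ N' : ℕ, (N' : ℤ) = ((r * (r ^ k * Q) : ℕ) : ℤ) + t :=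
      ⟨(((r * (r ^ k * Q) : ℕ) : ℤ) + t).toNat, by omega⟩
    have h1 : x (t + n) = fixedWord φ b N' :=
      hx N' _ (by rw [abs_le]; push_cast only [Nat.cast_add]; omega) (by rw [hN', hP]; ring)
    have h2 : x (r * t + i + n) = fixedWord φ b (r * N + i) := by
      refine hx _ _ (by rw [abs_le]; omega) ?_
      have h3 : ((r * N : ℕ) : ℤ) = ((r * (r ^ k * Q) : ℕ) : ℤ) + r * t := by
        rw [Nat.cast_mul, hN, Nat.cast_mul r]
        ring
      rw [Nat.cast_add, h3, hP]
      ring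
    -- With `N' = r^(k+1) Q + t` and `N = r^k Q + t`, the two agree modulo `r^k`, and modulo `m`
    -- since `r ≡ 1`. For `t ≠ 0` the bound `|t| < r^k` prevents divisibility; for `t = 0` one has
    -- `N' = r N`.
    have h3 : fixedWord φ b N' = fixedWord φ b N := by
      rcases eq_or_ne t 0 with rfl | ht
      · obtain rfl : N' = r * N := by
          zify
          rw [hN', hN]
          push_cast
          ring
        exact fixedWord_mul h.constantLength hr h.headFixing b N
      · refine h.congr k _ _ ?_ ?_ fun hdvd => ?_
        · rw [← Int.natCast_modEq_iff, hN, hN']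
          refine Int.ModEq.add_right _ (Int.natCast_modEq_iff.2 ?_)
          exact (Nat.modEq_zero_iff_dvd.2 ((Nat.dvd_mul_right _ _).mul_left _)).trans
            (Nat.modEq_zero_iff_dvd.2 (Nat.dvd_mul_right _ _)).symm
        · rw [← Int.natCast_modEq_iff, hN, hN']
          refine Int.ModEq.add_right _ (Int.natCast_modEq_iff.2 ?_)
          rw [← ZMod.natCast_eq_natCast_iff, Nat.cast_mul, h.length_eq_one, one_mul]
        · have h4 : ((r ^ k : ℕ) : ℤ) ∣ N' := by exact_mod_cast hdvd
          rw [hN', dvd_add_right (Int.natCast_dvd_natCast.2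
            ((Nat.dvd_mul_right _ _).mul_left _))] at h4
          have h5 := Nat.le_of_dvd (by omega) (Int.natCast_dvd.1 h4)
          omega
    change (φ (x (t + n)))[i]? = some (x (r * t + i + n))
    rw [h1, h2, h3]
    exact isFixedWord_fixedWord h.constantLength hr h.headFixing b N i hi

end CongruenceGenerated

/-! ### Continuity and the theorem -/

/-- The preimage of a closed set is a projection of a closed set along the compact factor `Y`. -/
theorem continuous_of_isClosed_graph {X Y : Type*} [TopologicalSpace X] [TopologicalSpace Y]
    [CompactSpace Y] {f : X → Y} (hf : IsClosed {p : X × Y | f p.1 = p.2}) : Continuous f := by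
  rw [continuous_iff_isClosed]
  intro F hF
  have : f ⁻¹' F = Prod.fst '' ({p : X × Y | f p.1 = p.2} ∩ Prod.snd ⁻¹' F) := by
    ext x
    constructor
    · exact fun hx => ⟨(x, f x), ⟨rfl, hx⟩, rfl⟩
    · rintro ⟨⟨_, y⟩, ⟨hy, hyF⟩, rfl⟩
      have hy : f _ = y := hy
      exact hy ▸ hyF
  rw [this]
  exact isClosedMap_fst_of_compactSpace _ (hf.inter (hF.preimage continuous_snd))

/-- For fixed `L` and `k` the condition involves finitely many coordinates, so it is the preimage of
a subset of a discrete space. -/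
theorem isClosed_setOf_isGeneratedBy {B : Type*} [TopologicalSpace B] [DiscreteTopology B]
    (φ : B → List B) (r m : ℕ) (b : B) :
    IsClosed {p : (ℤ → B) × ZMod m × (ℕ → Fin r) | IsGeneratedBy φ r m b p.1 p.2.1 p.2.2} := by
  simp only [IsGeneratedBy, Set.ofPred_forall]
  refine isClosed_iInter fun L => isClosed_iInter fun k => ?_
  let g : (ℤ → B) × ZMod m × (ℕ → Fin r) →
      (Finset.Icc (-L : ℤ) L → B) × ZMod m × (Finset.range k → Fin r) :=
    fun p => (fun i => p.1 i, p.2.1, fun i => p.2.2 i)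
  have hg : Continuous g := by fun_prop
  let S : Set ((Finset.Icc (-L : ℤ) L → B) × ZMod m × (Finset.range k → Fin r)) :=
    {p | ∃ M : ℕ, L < M ∧ (M : ZMod m) = p.2.1 ∧
      M ≡ ∑ i : Finset.range k, (p.2.2 i : ℕ) * r ^ (i : ℕ) [MOD r ^ k] ∧
      ∀ (n : ℕ) (i : Finset.Icc (-L : ℤ) L), (n : ℤ) = M + i → p.1 i = fixedWord φ b n}
  convert (isClosed_discrete S).preimage hg using 1
  ext p
  refine exists_congr fun M => and_congr_right fun _ => and_congr_right fun _ => ?_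
  refine and_congr ?_ ?_
  · rw [digitSum, ← Finset.sum_coe_sort]
  · exact ⟨fun hp n i => hp n i (abs_le.2 (Finset.mem_Icc.1 i.2)),
      fun hp n i hi => hp n ⟨i, Finset.mem_Icc.2 (abs_le.1 hi)⟩⟩

theorem CongruenceGenerated.exists_factorMap {B : Type*} [TopologicalSpace B]
    [DiscreteTopology B] [Finite B] {φ : B → List B} {r m : ℕ} [NeZero m] {b : B}
    (h : CongruenceGenerated φ r m b) :
    ∃ Ψ : space φ → ZMod m × (ℕ → Fin r),
      (∀ x c z, Ψ x = (c, z) ↔ IsPhase b m x.1 c ∧ IsAddress φ r x.1 z) ∧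
      IsFactorMap (spaceShift φ) (fun y => (y.1 + 1, odometer y.2)) Ψ ∧
      Set.InjOn Ψ {x | ∀ w, IsFixedPoint φ r w → x.1 ∉ orbit w} := by
  choose α f hΨ using fun x : space φ => h.exists_isGeneratedBy_of_mem x.2
  -- The chosen values are the only ones possible, since phase and address determine `c` and `z`.
  have hiff : ∀ x c z, (α x, f x) = (c, z) ↔ IsGeneratedBy φ r m b x.1 c z := by
    intro x c z
    rw [Prod.mk_inj]
    constructor
    · rintro ⟨rfl, rfl⟩
      exact hΨ x
    · intro hg
      obtain ⟨p, hp, hc⟩ := h.isPhase (hΨ x)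
      obtain ⟨p', hp', hc'⟩ := h.isPhase hg
      exact ⟨by rw [hc, hc', hp.unique hp'], h.address_unique hg (h.isAddress (hΨ x))⟩
  refine ⟨fun x => (α x, f x), fun x c z => (hiff x c z).trans (h.isGeneratedBy_iff x.2),
    ⟨?_, ?_, ?_⟩, ?_⟩
  · apply continuous_of_isClosed_graph
    have hcont : Continuous fun p : space φ × ZMod m × (ℕ → Fin r) => (p.1.1, p.2) := by fun_prop
    convert (isClosed_setOf_isGeneratedBy φ r m b).preimage hcont using 1
    ext p
    exact hiff p.1 p.2.1 p.2.2
  · rintro ⟨c, z⟩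
    obtain ⟨x, hx⟩ := h.exists_isGeneratedBy c z
    exact ⟨⟨x, h.mem_space hx⟩, (hiff _ _ _).2 hx⟩
  · exact fun x => (hiff _ _ _).2 (hΨ x).shift
  · intro x hx y _ hxy
    have hy := (hiff y _ _).1 hxy.symm
    rcases h.eq_or_mem_orbit (hΨ x) hy with he | ⟨w, hw, hxw⟩
    · exact Subtype.ext he
    · exact absurd hxw (hx w hw)

instance {A : Type*} [Finite A] (θ : A → List A) (o : A) (r : ℕ) : Finite (PairClass θ o r) :=
  inferInstanceAs (Finite (Quot _))

instance {A : Type*} (θ : A → List A) (o : A) (r : ℕ) : DiscreteTopology (PairClass θ o r) :=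
  ⟨rfl⟩

theorem congruenceGenerated_pairSubst {A : Type*} [Finite A] {o : A} {r : ℕ} {θ : A → List A}
    (hlen : ConstantLength θ r) (hadm : Admissible θ r) (hprim : IsPrimitive θ)
    (hcf : CoincidenceFree θ r) (hcan : Canonical θ) (hpart : PairPartition θ o r)
    (b : PairClass θ o r) : CongruenceGenerated (pairSubst θ o r) r (height θ o r) b := by
  have hr := two_le_of_admissible hlen hadm hcan o
  exact
    { constantLength := constantLength_pairSubst hlen (by omega)
      two_le := hr
      headFixing := headFixing_pairSubst
      length_eq_one := length_eq_one_mod_height hlen hr hcan o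
      congr := fun _ _ _ => fixedWord_pairSubst_congr hlen hr hcan hprim hpart b
      cast_eq := fun N N' he => by
        have h1 := letterType_lastLetter_fixedWord hlen hr hcan hprim hpart b N
        rw [he, letterType_lastLetter_fixedWord hlen hr hcan hprim hpart b N'] at h1
        exact (add_left_cancel h1).symm
      surj := exists_fixedWord_pairSubst_eq hlen hr hcan hprim hpart b
      not_periodic := fun c _ hq =>
        not_periodic_fixedWord_pairSubst hlen hr hcan hadm hprim hcf hpart c hq }

end Subst

theorem mainTheorem6 {A : Type*} [Finite A] (o : A) (r : ℕ) (θ : A → List A)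
    (hlen : Subst.ConstantLength θ r) (hadm : Subst.Admissible θ r) (hprim : Subst.IsPrimitive θ)
    (hcf : Subst.CoincidenceFree θ r) (hcan : Subst.Canonical θ)
    (hpart : Subst.PairPartition θ o r)
    (o' : Subst.PairClass θ o r)
    (ho' : ∀ w : Subst.legalPairs θ,
      Subst.pairClass θ o r w = o' → w.1.2 ∈ Subst.letterClass θ o r 0) :
    ∃ Ψ : Subst.space (Subst.pairSubst θ o r) → ZMod (Subst.height θ o r) × (ℕ → Fin r),
      (∀ x c z, Ψ x = (c, z) ↔
        Subst.IsPhase o' (Subst.height θ o r) x.1 c ∧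
          Subst.IsAddress (Subst.pairSubst θ o r) r x.1 z) ∧
      Subst.IsFactorMap (Subst.spaceShift (Subst.pairSubst θ o r))
        (fun y => (y.1 + 1, Subst.odometer y.2)) Ψ ∧
      Set.InjOn Ψ {x | ∀ w, Subst.IsFixedPoint (Subst.pairSubst θ o r) r w →
        x.1 ∉ Subst.orbit w} :=
  (Subst.congruenceGenerated_pairSubst hlen hadm hprim hcf hcan hpart o').exists_factorMap
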